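/- **Conventions.** Let $k$ be a field. A Brauer configuration $\mathscr M=(M,\mathscr M_1,\mu,\mathcal O)$ consists of a finite set $M$ of vertices, a finite family $\mathscr M_1=\{(U_1,f_1),\dots,(U_m,f_m)\}$ of multisets of vertices (polygons), where $f_i(v)$ is the number of times that $v$ occurs in the $i$th polygon, such that each polygon has at least two elements counted with repetition and every vertex occurs in some polygon, a multiplicity function $\mu:M\to\{1,2,\dots\}$, and an orientation $\mathcal O$, that is, for each vertex $v$ a circular order on its $val(v)=\sum_i f_i(v)$ occurrences in polygons. It is assumed that $\mu(v)\,val(v)>1$ for all $v\in M$. The Brauer quiver $Q_{\mathscr M}$ has the polygons as vertices, and one arrow for each occurrence of each vertex, from the polygon of this occurrence to the polygon of the next occurrence of the same vertex in its circular order (if $val(v)=1$, this is a loop). The special cycle of $v$ starting at an occurrence of $v$ is the product of the $val(v)$ arrows met when going once around the circular order of $v$ from there. The Brauer configuration algebra $\Lambda_{\mathscr M}$ is the path algebra $kQ_{\mathscr M}$ modulo the two-sided ideal generated by * $C^{\mu(v)}-D^{\mu(w)}$, where $C$ and $D$ are special cycles of vertices $v$ and $w$ starting at occurrences in the same polygon;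 * $C^{\mu(v)}a$, where $C$ is a special cycle of $v$ and $a$ is its first arrow; * $ab$, where $a,b$ are composable arrows such that $b$ is not the arrow following $a$ in the circular order of some vertex. $\mathscr M$ is connected if $m\ge 1$ and any two polygons are joined by a chain of polygons in which consecutive ones share a vertex. **Proposition 3.4.** Let $\mathscr M=(M,\mathscr M_1,\mu,\mathcal O)$ be a connected Brauer configuration with $m$ polygons, $\mathscr M_1=\{(U_1,f_1),\dots,(U_m,f_m)\}$, such that $f_i(u)=1$ for every $u\in U_i$, $1\le i\le m$. Suppose that $\mu(v)=2$ for each vertex $v$ with $val(v)=1$ and $\mu(v)=1$ for each other vertex, and that exactly $n$ vertices $v$ satisfy $val(v)=1$. Then the center of $\Lambda_{\mathscr M}$ satisfies $$\dim_k Z(\Lambda_{\mathscr M})=m+n+1.$$ -/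

import Mathlib

/-! ### Path algebras -/

section PathAlgebra

/-- The path algebra `kQ` of a quiver `Q` with finitely many vertices. Its underlying `k`-vector
space has the set of all paths of `Q` as a basis: an element assigns to each pair of vertices
`i, j` a finitely supported `k`-linear combination of the paths from `i` to `j`. -/
def PathAlgebra (k Q : Type*) [Field k] [Quiver Q] :=
  ∀ i j : Q, Quiver.Path i j →₀ k

namespace PathAlgebra

variable {k Q : Type*} [Field k] [Quiver Q]

noncomputable instance : AddCommGroup (PathAlgebra k Q) :=
  inferInstanceAs (AddCommGroup (∀ i j : Q, Quiver.Path i j →₀ k))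

noncomputable instance : Module k (PathAlgebra k Q) :=
  inferInstanceAs (Module k (∀ i j : Q, Quiver.Path i j →₀ k))

/-- Concatenation of paths (first `p`, then `q`), extended bilinearly. -/
noncomputable def concat (i l j : Q) :
    (Quiver.Path i l →₀ k) →ₗ[k] (Quiver.Path l j →₀ k) →ₗ[k] (Quiver.Path i j →₀ k) :=
  Finsupp.lsum k fun p : Quiver.Path i l =>
    LinearMap.toSpanSingleton k _ (Finsupp.lmapDomain k k fun q : Quiver.Path l j => p.comp q)

theorem concat_single {i l j : Q} (p : Quiver.Path i l) (q : Quiver.Path l j) (a b : k) :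
    concat i l j (Finsupp.single p a) (Finsupp.single q b)
      = Finsupp.single (p.comp q) (a * b) := by
  simp [concat]

theorem concat_assoc {i l m j : Q} (f : Quiver.Path i l →₀ k) (g : Quiver.Path l m →₀ k)
    (h : Quiver.Path m j →₀ k) :
    concat i m j (concat i l m f g) h = concat i l j f (concat l m j g h) := by
  induction f using Finsupp.induction_linear with
  | zero => simp
  | add f₁ f₂ h₁ h₂ => simp [h₁, h₂]
  | single p a =>
    induction g using Finsupp.induction_linear with
    | zero => simp
    | add f₁ f₂ h₁ h₂ => simp [h₁, h₂]
    | single q b =>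
      induction h using Finsupp.induction_linear with
      | zero => simp
      | add f₁ f₂ h₁ h₂ => simp [h₁, h₂]
      | single r c => simp only [concat_single, mul_assoc, Quiver.Path.comp_assoc]

theorem nil_concat {i j : Q} (f : Quiver.Path i j →₀ k) :
    concat i i j (Finsupp.single Quiver.Path.nil 1) f = f := by
  induction f using Finsupp.induction_linear with
  | zero => simp
  | add f₁ f₂ h₁ h₂ => simp [h₁, h₂]
  | single p a => simp [concat_single]

theorem concat_nil {i j : Q} (f : Quiver.Path i j →₀ k) :
    concat i j j f (Finsupp.single Quiver.Path.nil 1) = f := by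
  induction f using Finsupp.induction_linear with
  | zero => simp
  | add f₁ f₂ h₁ h₂ => simp [h₁, h₂]
  | single p a => simp [concat_single]

theorem add_apply (f g : PathAlgebra k Q) (i j : Q) : (f + g) i j = f i j + g i j := rfl

theorem zero_apply (i j : Q) : (0 : PathAlgebra k Q) i j = 0 := rfl

theorem smul_apply (c : k) (f : PathAlgebra k Q) (i j : Q) : (c • f) i j = c • f i j := rfl

section

variable [DecidableEq Q]

/-- The basis element of `kQ` given by a path. -/
noncomputable def ofPath (k : Type*) [Field k] {i j : Q} (p : Quiver.Path i j) :
    PathAlgebra k Q :=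
  Pi.single i (Pi.single j (Finsupp.single p 1))

/-- The identity is the sum of all paths of length `0`. -/
noncomputable instance : One (PathAlgebra k Q) :=
  ⟨fun i => Pi.single i (Finsupp.single Quiver.Path.nil 1)⟩

theorem one_apply (i : Q) :
    (1 : PathAlgebra k Q) i = Pi.single i (Finsupp.single Quiver.Path.nil 1) := rfl

theorem one_apply_same (i : Q) :
    (1 : PathAlgebra k Q) i i = Finsupp.single Quiver.Path.nil 1 := by
  simp [one_apply]

theorem one_apply_ne {i j : Q} (h : i ≠ j) : (1 : PathAlgebra k Q) i j = 0 := by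
  simp [one_apply, Pi.single_eq_of_ne h.symm]

end

variable [Fintype Q]

/-- The product: concatenate composable paths, the product of non-composable paths being `0`. -/
noncomputable instance : Mul (PathAlgebra k Q) :=
  ⟨fun f g i j => ∑ l, concat i l j (f i l) (g l j)⟩

theorem mul_apply (f g : PathAlgebra k Q) (i j : Q) :
    (f * g) i j = ∑ l, concat i l j (f i l) (g l j) := rfl

variable [DecidableEq Q]

noncomputable instance : Ring (PathAlgebra k Q) :=
  { (inferInstance : AddCommGroup (PathAlgebra k Q)),
    (inferInstance : Mul (PathAlgebra k Q)),
    (inferInstance : One (PathAlgebra k Q)) with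
    left_distrib := fun f g h => by
      funext i j
      simp [mul_apply, add_apply, Finset.sum_add_distrib]
    right_distrib := fun f g h => by
      funext i j
      simp [mul_apply, add_apply, Finset.sum_add_distrib]
    zero_mul := fun f => by
      funext i j
      simp [mul_apply, zero_apply]
    mul_zero := fun f => by
      funext i j
      simp [mul_apply, zero_apply]
    mul_assoc := fun f g h => by
      funext i j
      simp only [mul_apply, map_sum, LinearMap.sum_apply, concat_assoc]
      exact Finset.sum_comm
    one_mul := fun f => by
      funext i j
      rw [mul_apply, Finset.sum_eq_single i, one_apply_same, nil_concat]
      · intro l _ hl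
        simp [one_apply_ne hl.symm]
      · simp
    mul_one := fun f => by
      funext i j
      rw [mul_apply, Finset.sum_eq_single j, one_apply_same, concat_nil]
      · intro l _ hl
        simp [one_apply_ne hl]
      · simp }

noncomputable instance : Algebra k (PathAlgebra k Q) :=
  Algebra.ofModule
    (fun c f g => by
      funext i j
      simp [mul_apply, smul_apply, Finset.smul_sum])
    (fun c f g => by
      funext i j
      simp [mul_apply, smul_apply, Finset.smul_sum])

end PathAlgebra

end PathAlgebra

/-! ### Brauer configurations -/

/-- The occurrences of the vertex `v` in the polygons of a family of multisets with frequency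
functions `f i`: the polygon `i` contributes `f i v` copies of itself. -/
abbrev VertexOccurrence {V P : Type*} (f : P → V → ℕ) (v : V) := Σ i : P, Fin (f i v)

/-- A Brauer configuration with vertex set `V` and polygons indexed by `P`. -/
structure BrauerConfiguration (V P : Type*) [Fintype V] [Fintype P] where
  /-- `freq i v` is the number of times that the vertex `v` occurs in the polygon `i`. -/
  freq : P → V → ℕ
  /-- Every vertex lies in some polygon. -/
  covers : ∀ v, ∃ i, 0 < freq i v
  /-- Every polygon has at least two vertices, counted with repetition. -/
  one_lt_size : ∀ i, 1 < ∑ v, freq i v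
  /-- The multiplicity function (not to be confused with the frequencies). -/
  mult : V → ℕ
  mult_pos : ∀ v, 0 < mult v
  /-- All vertices are non-truncated: multiplicity times valency is greater than `1`. -/
  nontruncated : ∀ v, 1 < mult v * ∑ i, freq i v
  /-- The orientation: a circular order on the occurrences of each vertex, given by its
  successor map. -/
  next : ∀ v, Equiv.Perm (VertexOccurrence freq v)
  /-- The successor map of a vertex runs through all its occurrences in one cycle. -/
  next_cyclic : ∀ v (x y : VertexOccurrence freq v), (next v).SameCycle x y

namespace BrauerConfiguration

variable {V P : Type*} [Fintype V] [Fintype P]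

/-- The valency of a vertex: the number of its occurrences in all the polygons. -/
def val (Γ : BrauerConfiguration V P) (v : V) : ℕ := ∑ i, Γ.freq i v

/-- Connectedness: there is a polygon, and any two polygons are joined by a chain of polygons in
which consecutive ones share a vertex. -/
def Connected (Γ : BrauerConfiguration V P) : Prop :=
  (SimpleGraph.fromRel fun i j : P => ∃ v, 0 < Γ.freq i v ∧ 0 < Γ.freq j v).Connected

/-- The occurrences of all vertices in all polygons. -/
abbrev Occurrence (Γ : BrauerConfiguration V P) := Σ v : V, VertexOccurrence Γ.freq v

/-- The polygon in which an occurrence takes place. -/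
def polygon (Γ : BrauerConfiguration V P) (x : Γ.Occurrence) : P := x.2.1

/-- The next occurrence of the same vertex in the circular order. -/
def succ (Γ : BrauerConfiguration V P) (x : Γ.Occurrence) : Γ.Occurrence :=
  ⟨x.1, Γ.next x.1 x.2⟩

/-- The vertex set of the Brauer quiver: the set of polygons. -/
def QuiverVertex (_Γ : BrauerConfiguration V P) : Type _ := P

instance (Γ : BrauerConfiguration V P) : Fintype Γ.QuiverVertex := inferInstanceAs (Fintype P)

instance (Γ : BrauerConfiguration V P) [DecidableEq P] : DecidableEq Γ.QuiverVertex :=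
  inferInstanceAs (DecidableEq P)

/-- The Brauer quiver: each occurrence `x` of a vertex gives one arrow, from the polygon of `x` to
the polygon of the next occurrence of the same vertex. -/
instance (Γ : BrauerConfiguration V P) : Quiver Γ.QuiverVertex where
  Hom i j := {x : Γ.Occurrence // Γ.polygon x = i ∧ Γ.polygon (Γ.succ x) = j}

variable [DecidableEq P] (k : Type*) [Field k]

/-- The arrow of the Brauer quiver that starts at the occurrence `x`, as an element of the path
algebra. -/
noncomputable def arrow (Γ : BrauerConfiguration V P) (x : Γ.Occurrence) :
    PathAlgebra k Γ.QuiverVertex :=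
  let a : (show Γ.QuiverVertex from Γ.polygon x) ⟶
      (show Γ.QuiverVertex from Γ.polygon (Γ.succ x)) := ⟨x, rfl, rfl⟩
  PathAlgebra.ofPath k a.toPath

/-- The special cycle starting at the occurrence `x` of a vertex `v`: the product of the `val v`
arrows met when going once around the circular order of `v`. -/
noncomputable def specialCycle (Γ : BrauerConfiguration V P) (x : Γ.Occurrence) :
    PathAlgebra k Γ.QuiverVertex :=
  ((List.range (Γ.val x.1)).map fun n => Γ.arrow k (Γ.succ^[n] x)).prod

/-- The relations that define the Brauer configuration algebra. -/
inductive IsRelation (Γ : BrauerConfiguration V P) : PathAlgebra k Γ.QuiverVertex → Prop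
  /-- `C ^ μ(v) - C' ^ μ(w)` for the special cycles at occurrences of vertices `v`, `w` in one and
  the same polygon. -/
  | cycle_sub_cycle (x y : Γ.Occurrence) (h : Γ.polygon x = Γ.polygon y) :
      IsRelation Γ (Γ.specialCycle k x ^ Γ.mult x.1 - Γ.specialCycle k y ^ Γ.mult y.1)
  /-- `C ^ μ(v) a`, where `a` is the first arrow of the special cycle `C` of the vertex `v`. -/
  | cycle_mul_arrow (x : Γ.Occurrence) :
      IsRelation Γ (Γ.specialCycle k x ^ Γ.mult x.1 * Γ.arrow k x)
  /-- `a b` for composable arrows `a`, `b` such that `b` does not follow `a` in a special cycle; in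
  particular for composable arrows that belong to different vertices of the configuration. -/
  | arrow_mul_arrow (x y : Γ.Occurrence) (h : Γ.polygon (Γ.succ x) = Γ.polygon y)
      (hne : y ≠ Γ.succ x) :
      IsRelation Γ (Γ.arrow k x * Γ.arrow k y)

/-- The Brauer configuration algebra: the path algebra of the Brauer quiver modulo the two-sided
ideal generated by the relations. -/
abbrev BrauerAlgebra (Γ : BrauerConfiguration V P) : Type _ :=
  (TwoSidedIdeal.span {r | Γ.IsRelation k r}).ringCon.Quotient

end BrauerConfiguration

/-! ### Products of paths and vertex idempotents in the path algebra. -/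

namespace PathAlgebra

variable {k Q : Type*} [Field k] [Quiver Q] [DecidableEq Q]

/-! Modulo the relations, a nontrivial path vanishes unless it follows the circular order of a
single vertex `v` for at most the full length `μ(v) val(v)` (`proj_ofPath_cons`), and the walks of
full length that start in one polygon are identified. A polygon contains each vertex at most once,
so a walk that returns to its polygon returns to its occurrence, and its length is a multiple of
`val(v)`. By the choice of `μ`, the nontrivial closed paths that survive are the `n` loops at the
vertices of valency one and the full cycles, one class for each of the `m` polygons. All of these
are central: arrows kill the full cycles, and arrows other than the loop kill a loop, on both sides.

Conversely, a central element is the sum of its corners `e_i z e_i`. Subtracting loops and full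
cycles leaves a central combination of the `e_i`. Comparing its products with an arrow shows that
the coefficients agree at both ends of the arrow, and connectedness makes it a multiple of `1`
(`center_le_span`).

Independence in the quotient is tested by functionals. If a set `S` of words is stable under the
relations, the sum of the coefficients of the paths between two fixed nodes with words in `S`
vanishes on the ideal (`IsCompatible.coeff_eq_zero`). The empty word, the one-letter words and the
set of all full words give functionals dual to the family. -/

theorem ofPath_apply {i j : Q} (p : Quiver.Path i j) :
    ofPath k p i j = Finsupp.single p 1 := by
  simp [ofPath]

theorem ofPath_apply_ne_left {i j : Q} (p : Quiver.Path i j) {a : Q} (h : a ≠ i) (b : Q) :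
    ofPath k p a b = 0 := by
  simp [ofPath, Pi.single_eq_of_ne h]

theorem ofPath_apply_ne_right {i j : Q} (p : Quiver.Path i j) {b : Q} (h : b ≠ j) (a : Q) :
    ofPath k p a b = 0 := by
  by_cases ha : a = i
  · subst ha
    simp [ofPath, Pi.single_eq_of_ne h]
  · exact ofPath_apply_ne_left p ha b

variable [Fintype Q]

theorem ofPath_mul_ofPath {i l j : Q} (p : Quiver.Path i l) (q : Quiver.Path l j) :
    ofPath k p * ofPath k q = ofPath k (p.comp q) := by
  funext a b
  rw [mul_apply]
  by_cases ha : a = i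
  · subst ha
    by_cases hb : b = j
    · subst hb
      rw [Finset.sum_eq_single l]
      · simp [ofPath_apply, concat_single]
      · intro c _ hc
        simp [ofPath_apply_ne_left q hc]
      · simp
    · simp [ofPath_apply_ne_right _ hb]
  · simp [ofPath_apply_ne_left _ ha]

theorem ofPath_mul_ofPath_of_ne {i l l' j : Q} (p : Quiver.Path i l) (q : Quiver.Path l' j)
    (h : l ≠ l') : ofPath k p * ofPath k q = 0 := by
  funext a b
  rw [mul_apply]
  refine Finset.sum_eq_zero fun c _ => ?_
  by_cases hc : c = l
  · subst hc
    simp [ofPath_apply_ne_left q h]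
  · simp [ofPath_apply_ne_right p hc]

/-- The inclusion of the span of the paths from `i` to `j` into the path algebra. -/
noncomputable def ofHom (k : Type*) [Field k] (i j : Q) :
    (Quiver.Path i j →₀ k) →ₗ[k] PathAlgebra k Q :=
  (LinearMap.single k (fun i : Q => ∀ j : Q, Quiver.Path i j →₀ k) i).comp
    (LinearMap.single k (fun j : Q => Quiver.Path i j →₀ k) j)

theorem sum_ofHom (f : PathAlgebra k Q) : f = ∑ i, ∑ j, ofHom k i j (f i j) := by
  have h : ∀ i, ∑ j, ofHom k i j (f i j)
      = LinearMap.single k (fun i : Q => ∀ j : Q, Quiver.Path i j →₀ k) i (f i) := fun i => by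
    conv_rhs => rw [← Finset.univ_sum_single (f i)]
    rw [map_sum]
    rfl
  rw [Finset.sum_congr rfl fun i _ => h i]
  exact (Finset.univ_sum_single (M := fun i : Q => ∀ j : Q, Quiver.Path i j →₀ k) f).symm

theorem ofHom_single {i j : Q} (p : Quiver.Path i j) (c : k) :
    ofHom k i j (Finsupp.single p c) = c • ofPath k p := by
  rw [← mul_one c, ← smul_eq_mul, ← Finsupp.smul_single, map_smul]
  simp only [smul_eq_mul, mul_one]
  rfl

@[elab_as_elim]
theorem induction_path {motive : PathAlgebra k Q → Prop} (f : PathAlgebra k Q)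
    (zero : motive 0) (add : ∀ f g, motive f → motive g → motive (f + g))
    (smul : ∀ (c : k) f, motive f → motive (c • f))
    (path : ∀ (i j : Q) (p : Quiver.Path i j), motive (ofPath k p)) : motive f := by
  rw [sum_ofHom f]
  refine Finset.sum_induction _ motive add zero fun i _ =>
    Finset.sum_induction _ motive add zero fun j _ => ?_
  induction f i j using Finsupp.induction_linear with
  | zero => simpa using zero
  | add f g hf hg => simpa using add _ _ hf hg
  | single p c =>
    rw [ofHom_single]
    exact smul _ _ (path _ _ _)

/-- The primitive idempotent at a vertex. -/
noncomputable def idem (k : Type*) [Field k] (i : Q) : PathAlgebra k Q :=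
  ofPath k (Quiver.Path.nil : Quiver.Path i i)

theorem one_eq_sum_idem : (1 : PathAlgebra k Q) = ∑ i, idem k i :=
  (Finset.univ_sum_single (M := fun i : Q => ∀ j : Q, Quiver.Path i j →₀ k)
    (1 : PathAlgebra k Q)).symm

theorem idem_mul_ofPath {i j : Q} (p : Quiver.Path i j) :
    idem k i * ofPath k p = ofPath k p := by
  rw [idem, ofPath_mul_ofPath, Quiver.Path.nil_comp]

theorem ofPath_mul_idem {i j : Q} (p : Quiver.Path i j) :
    ofPath k p * idem k j = ofPath k p := by
  rw [idem, ofPath_mul_ofPath, Quiver.Path.comp_nil]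

theorem idem_mul_idem (i : Q) : idem k i * idem k i = idem k i :=
  idem_mul_ofPath _

theorem idem_mul_idem_of_ne {i j : Q} (h : i ≠ j) : idem k i * idem k j = 0 :=
  ofPath_mul_ofPath_of_ne _ _ h

theorem idem_mul_ofPath_of_ne {i j l : Q} (p : Quiver.Path i j) (h : l ≠ i) :
    idem k l * ofPath k p = 0 :=
  ofPath_mul_ofPath_of_ne _ _ h

theorem ofPath_mul_idem_of_ne {i j l : Q} (p : Quiver.Path i j) (h : j ≠ l) :
    ofPath k p * idem k l = 0 :=
  ofPath_mul_ofPath_of_ne _ _ h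

theorem idem_mul_mul_idem_mem_span (i : Q) (f : PathAlgebra k Q) :
    idem k i * f * idem k i
      ∈ Submodule.span k (Set.range fun p : Quiver.Path i i => ofPath k p) := by
  induction f using induction_path with
  | zero => simp
  | add f g hf hg => simpa [mul_add, add_mul] using add_mem hf hg
  | smul c f hf => simpa using Submodule.smul_mem _ c hf
  | path a b p =>
    by_cases ha : i = a
    · subst ha
      rw [idem_mul_ofPath]
      by_cases hb : b = i
      · subst hb
        rw [ofPath_mul_idem]
        exact Submodule.subset_span ⟨p, rfl⟩
      · simp [ofPath_mul_idem_of_ne p hb]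
    · simp [idem_mul_ofPath_of_ne p ha]

end PathAlgebra

/-! ### Circular orders on occurrences and the words of paths. -/

namespace BrauerConfiguration

open PathAlgebra

variable {V P : Type*} [Fintype V] [Fintype P] (Γ : BrauerConfiguration V P)

theorem card_vertexOccurrence (v : V) : Fintype.card (VertexOccurrence Γ.freq v) = Γ.val v := by
  simp [val]

theorem isCycleOn_next (v : V) :
    (Γ.next v).IsCycleOn ((Finset.univ : Finset (VertexOccurrence Γ.freq v)) : Set _) := by
  rw [Finset.coe_univ]
  exact ⟨Set.bijOn_univ.2 (Γ.next v).bijective, fun x _ y _ => Γ.next_cyclic v x y⟩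

theorem succ_iterate (x : Γ.Occurrence) (n : ℕ) :
    Γ.succ^[n] x = ⟨x.1, (Γ.next x.1 ^ n) x.2⟩ := by
  induction n with
  | zero => rfl
  | succ n ih =>
    rw [Function.iterate_succ_apply', ih, pow_succ', Equiv.Perm.mul_apply]
    rfl

theorem succ_iterate_fst (x : Γ.Occurrence) (n : ℕ) : (Γ.succ^[n] x).1 = x.1 := by
  rw [succ_iterate]

/-- The successor map of a vertex is a single cycle through its `val` occurrences. -/
theorem succ_iterate_eq_self_iff (x : Γ.Occurrence) (n : ℕ) :
    Γ.succ^[n] x = x ↔ Γ.val x.1 ∣ n := by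
  obtain ⟨v, x⟩ := x
  rw [succ_iterate, ← card_vertexOccurrence, ← Finset.card_univ,
    ← (Γ.isCycleOn_next v).pow_apply_eq (Finset.mem_univ x)]
  simp

theorem exists_succ_iterate_eq {x y : Γ.Occurrence} (h : x.1 = y.1) : ∃ n, Γ.succ^[n] x = y := by
  obtain ⟨v, x⟩ := x
  obtain ⟨w, y⟩ := y
  obtain rfl : v = w := h
  obtain ⟨n, -, hn⟩ :=
    (Γ.isCycleOn_next v).exists_pow_eq (Finset.mem_univ x) (Finset.mem_univ y)
  exact ⟨n, by rw [succ_iterate]; exact congrArg _ hn⟩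

theorem succ_injective : Function.Injective Γ.succ := by
  rintro ⟨v, x⟩ ⟨w, y⟩ h
  obtain rfl : v = w := congrArg Sigma.fst h
  exact congrArg _ ((Γ.next v).injective (eq_of_heq (Sigma.mk.inj h).2))

/-- The length `μ(v) val(v)` of the power of a special cycle that occurs in the relations. -/
def fullLength (x : Γ.Occurrence) : ℕ := Γ.mult x.1 * Γ.val x.1

theorem one_lt_fullLength (x : Γ.Occurrence) : 1 < Γ.fullLength x := Γ.nontruncated x.1

theorem val_dvd_fullLength (x : Γ.Occurrence) : Γ.val x.1 ∣ Γ.fullLength x := Dvd.intro_left _ rfl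

theorem succ_iterate_fullLength (x : Γ.Occurrence) : Γ.succ^[Γ.fullLength x] x = x :=
  (Γ.succ_iterate_eq_self_iff x _).2 (Γ.val_dvd_fullLength x)

/-- The occurrences met by the full power of the special cycle starting at an occurrence. -/
def fullList (x : Γ.Occurrence) : List Γ.Occurrence :=
  (List.range (Γ.fullLength x)).map fun t => Γ.succ^[t] x

theorem length_fullList (x : Γ.Occurrence) : (Γ.fullList x).length = Γ.fullLength x := by
  simp [fullList]

theorem mem_fullList_self (x : Γ.Occurrence) : x ∈ Γ.fullList x :=
  List.mem_map.2 ⟨0, List.mem_range.2 (by have := Γ.one_lt_fullLength x; omega), rfl⟩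

theorem fst_eq_of_mem_fullList {x y : Γ.Occurrence} (h : y ∈ Γ.fullList x) : y.1 = x.1 := by
  obtain ⟨t, -, rfl⟩ := List.mem_map.1 h
  exact Γ.succ_iterate_fst x t

/-- Any letter of a full word determines its vertex, hence its length, so one full word cannot be a
proper factor of another. -/
theorem eq_nil_of_append_fullList_append {x z : Γ.Occurrence} {l₁ l₂ : List Γ.Occurrence}
    (h : l₁ ++ (Γ.fullList x ++ l₂) = Γ.fullList z) : l₁ = [] ∧ l₂ = [] := by
  have hx : x.1 = z.1 := Γ.fst_eq_of_mem_fullList (h ▸ by simp [mem_fullList_self])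
  have hl := congrArg List.length h
  have : Γ.fullLength x = Γ.fullLength z := by simp [fullLength, hx]
  simp only [List.length_append, length_fullList] at hl
  exact ⟨List.eq_nil_of_length_eq_zero (by omega), List.eq_nil_of_length_eq_zero (by omega)⟩

theorem eq_succ_of_append_cons_cons {x y z : Γ.Occurrence} {l₁ l₂ : List Γ.Occurrence}
    (h : l₁ ++ x :: y :: l₂ = Γ.fullList z) : y = Γ.succ x := by
  have hl := congrArg List.length h
  simp only [length_fullList, List.length_append, List.length_cons] at hl
  have h1 := congrArg (fun l => l[l₁.length]?) h
  have h2 := congrArg (fun l => l[l₁.length + 1]?) h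
  have e1 : l₁.length < Γ.fullLength z := by omega
  have e2 : l₁.length + 1 < Γ.fullLength z := by omega
  simp only [fullList, List.getElem?_map, List.getElem?_range, e1, e2, Option.map_some] at h1 h2
  simp at h1 h2
  rw [h1, h2, ← Function.iterate_succ_apply, Function.iterate_succ_apply']

/-- The polygon of an occurrence, as a vertex of the Brauer quiver. -/
def node (x : Γ.Occurrence) : Γ.QuiverVertex := Γ.polygon x

/-- The occurrences from which the arrows of a path start. -/
def occs {Γ : BrauerConfiguration V P} {i : Γ.QuiverVertex} :
    {j : Γ.QuiverVertex} → Quiver.Path i j → List Γ.Occurrence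
  | _, .nil => []
  | _, .cons p a => occs p ++ [a.1]

variable {Γ}

theorem occs_nil {i : Γ.QuiverVertex} : occs (Quiver.Path.nil : Quiver.Path i i) = [] := rfl

theorem occs_cons {i j l : Γ.QuiverVertex} (p : Quiver.Path i j) (a : j ⟶ l) :
    occs (p.cons a) = occs p ++ [a.1] := rfl

theorem occs_comp {i j l : Γ.QuiverVertex} (p : Quiver.Path i j) (q : Quiver.Path j l) :
    occs (p.comp q) = occs p ++ occs q := by
  induction q with
  | nil => simp [occs_nil]
  | cons q a ih => simp [occs_cons, ih]

/-! ### Walks along a circular order as elements of the path algebra. -/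

variable (Γ) [DecidableEq P] (k : Type*) [Field k]

theorem arrow_eq_ofPath {i j : Γ.QuiverVertex} (a : i ⟶ j) :
    Γ.arrow k a.1 = ofPath k a.toPath := by
  obtain ⟨x, rfl, rfl⟩ := a
  rfl

theorem ofPath_cons {i j l : Γ.QuiverVertex} (p : Quiver.Path i j) (a : j ⟶ l) :
    ofPath k (p.cons a) = ofPath k p * Γ.arrow k a.1 := by
  rw [arrow_eq_ofPath, ofPath_mul_ofPath]
  rfl

/-- The product of `n` consecutive arrows, starting from a given occurrence. -/
noncomputable def walk (x : Γ.Occurrence) (n : ℕ) : PathAlgebra k Γ.QuiverVertex :=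
  ((List.range n).map fun t => Γ.arrow k (Γ.succ^[t] x)).prod

theorem walk_zero (x : Γ.Occurrence) : Γ.walk k x 0 = 1 := rfl

theorem walk_one (x : Γ.Occurrence) : Γ.walk k x 1 = Γ.arrow k x := by
  simp [walk]

theorem walk_succ (x : Γ.Occurrence) (n : ℕ) :
    Γ.walk k x (n + 1) = Γ.walk k x n * Γ.arrow k (Γ.succ^[n] x) := by
  simp [walk, List.range_succ]

theorem walk_add (x : Γ.Occurrence) (n m : ℕ) :
    Γ.walk k x (n + m) = Γ.walk k x n * Γ.walk k (Γ.succ^[n] x) m := by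
  induction m with
  | zero => simp [walk_zero]
  | succ m ih =>
    rw [← add_assoc, walk_succ, ih, walk_succ, mul_assoc, ← Function.iterate_add_apply,
      add_comm m n]

theorem walk_succ' (x : Γ.Occurrence) (n : ℕ) :
    Γ.walk k x (n + 1) = Γ.arrow k x * Γ.walk k (Γ.succ x) n := by
  rw [add_comm, walk_add, walk_one]
  rfl

theorem specialCycle_pow (x : Γ.Occurrence) :
    Γ.specialCycle k x ^ Γ.mult x.1 = Γ.walk k x (Γ.fullLength x) := by
  have h : ∀ n, Γ.specialCycle k x ^ n = Γ.walk k x (n * Γ.val x.1) := fun n => by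
    induction n with
    | zero => simp [walk_zero]
    | succ n ih =>
      rw [pow_succ, ih, add_mul, one_mul, walk_add,
        (Γ.succ_iterate_eq_self_iff x _).2 (Dvd.intro_left _ rfl)]
      rfl
  exact h _

/-- The idempotent matters only for `n = 0`, where the walk is the empty product `1`, a sum over all
nodes and not a single path. -/
theorem exists_path_walk (x : Γ.Occurrence) (n : ℕ) {i j : Γ.QuiverVertex}
    (hi : Γ.node x = i) (hj : Γ.node (Γ.succ^[n] x) = j) :
    ∃ p : Quiver.Path i j,
      occs p = ((List.range n).map fun t => Γ.succ^[t] x) ∧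
      ofPath k p = idem k i * Γ.walk k x n := by
  subst hi
  induction n generalizing j with
  | zero =>
    subst hj
    exact ⟨.nil, rfl, by rw [walk_zero, mul_one]; rfl⟩
  | succ n ih =>
    obtain ⟨p, hp, hp'⟩ := ih rfl
    refine ⟨p.cons ⟨Γ.succ^[n] x, rfl, by rw [← Function.iterate_succ_apply' Γ.succ]; exact hj⟩,
      ?_, ?_⟩
    · rw [occs_cons, hp, List.range_succ, List.map_append]
      rfl
    · rw [ofPath_cons, hp', walk_succ, mul_assoc]

/-- The arrow of the Brauer quiver starting at an occurrence. -/
def step (x : Γ.Occurrence) : Γ.node x ⟶ Γ.node (Γ.succ x) := ⟨x, rfl, rfl⟩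

theorem idem_mul_arrow (x : Γ.Occurrence) :
    idem k (Γ.node x) * Γ.arrow k x = Γ.arrow k x := by
  exact idem_mul_ofPath (Γ.step x).toPath

theorem idem_mul_arrow_of_ne (x : Γ.Occurrence) {i : Γ.QuiverVertex} (h : i ≠ Γ.node x) :
    idem k i * Γ.arrow k x = 0 := by
  exact idem_mul_ofPath_of_ne (Γ.step x).toPath h

theorem arrow_mul_idem (x : Γ.Occurrence) :
    Γ.arrow k x * idem k (Γ.node (Γ.succ x)) = Γ.arrow k x := by
  exact ofPath_mul_idem (Γ.step x).toPath

theorem arrow_mul_idem_of_ne (x : Γ.Occurrence) {i : Γ.QuiverVertex} (h : Γ.node (Γ.succ x) ≠ i) :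
    Γ.arrow k x * idem k i = 0 := by
  exact ofPath_mul_idem_of_ne (Γ.step x).toPath h

theorem arrow_mul_arrow_of_ne {x y : Γ.Occurrence} (h : Γ.node (Γ.succ x) ≠ Γ.node y) :
    Γ.arrow k x * Γ.arrow k y = 0 := by
  rw [← arrow_mul_idem, mul_assoc, idem_mul_arrow_of_ne _ _ _ h, mul_zero]

theorem idem_mul_walk (x : Γ.Occurrence) (n : ℕ) :
    idem k (Γ.node x) * Γ.walk k x (n + 1) = Γ.walk k x (n + 1) := by
  rw [walk_succ', ← mul_assoc, idem_mul_arrow]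

theorem exists_path_full (x : Γ.Occurrence) {i : Γ.QuiverVertex} (h : Γ.node x = i) :
    ∃ p : Quiver.Path i i, occs p = Γ.fullList x ∧
      ofPath k p = Γ.specialCycle k x ^ Γ.mult x.1 := by
  obtain ⟨p, hp, hp'⟩ := Γ.exists_path_walk k x (Γ.fullLength x) h
    (by rw [succ_iterate_fullLength, h])
  refine ⟨p, hp, ?_⟩
  obtain ⟨n, hn⟩ : ∃ n, Γ.fullLength x = n + 1 := ⟨Γ.fullLength x - 1, by
    have := Γ.one_lt_fullLength x; omega⟩
  rw [hp', specialCycle_pow, ← h, hn, idem_mul_walk]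

theorem exists_path_arrow (x : Γ.Occurrence) :
    ∃ p : Quiver.Path (Γ.node x) (Γ.node (Γ.succ x)), occs p = [x] ∧
      ofPath k p = Γ.arrow k x :=
  ⟨(Γ.step x).toPath, rfl, rfl⟩

end BrauerConfiguration

/-! ### Coefficient functionals vanishing on the ideal of relations. -/

namespace BrauerConfiguration

open PathAlgebra

variable {V P : Type*} [Fintype V] [Fintype P] (Γ : BrauerConfiguration V P)

/-- Sets of words in the occurrences such that counting the paths with words in the set is
compatible with the relations of the Brauer configuration algebra. -/
structure IsCompatible (S : Set (List Γ.Occurrence)) : Prop where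
  full : ∀ {x y : Γ.Occurrence} (l₁ l₂ : List Γ.Occurrence), Γ.polygon x = Γ.polygon y →
    l₁ ++ (Γ.fullList x ++ l₂) ∈ S → l₁ ++ (Γ.fullList y ++ l₂) ∈ S
  full_cons : ∀ (x : Γ.Occurrence) (l₁ l₂ : List Γ.Occurrence),
    l₁ ++ (Γ.fullList x ++ x :: l₂) ∉ S
  cons_cons : ∀ {x y : Γ.Occurrence} (l₁ l₂ : List Γ.Occurrence), y ≠ Γ.succ x →
    l₁ ++ x :: y :: l₂ ∉ S

/-- Every word in the three conditions has at least two letters, because no vertex is truncated. -/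
theorem isCompatible_of_length_le_one {S : Set (List Γ.Occurrence)}
    (h : ∀ l ∈ S, l.length ≤ 1) : Γ.IsCompatible S where
  full {x y} l₁ l₂ _ hS := by
    have := h _ hS
    have := Γ.one_lt_fullLength x
    simp only [List.length_append, length_fullList] at *
    omega
  full_cons x l₁ l₂ hS := by
    have := h _ hS
    have := Γ.one_lt_fullLength x
    simp only [List.length_append, length_fullList] at *
    omega
  cons_cons {x y} l₁ l₂ _ hS := by
    have := h _ hS
    simp only [List.length_append, List.length_cons] at *
    omega

/-- A full word inside a full word is all of it, so an exchange yields a full word again and no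
letter can be appended; adjacent letters of a full word are always successors. -/
theorem isCompatible_range_fullList : Γ.IsCompatible (Set.range Γ.fullList) where
  full {x y} l₁ l₂ _ := by
    rintro ⟨z, hz⟩
    obtain ⟨rfl, rfl⟩ := Γ.eq_nil_of_append_fullList_append hz.symm
    exact ⟨y, by simp⟩
  full_cons x l₁ l₂ := by
    rintro ⟨z, hz⟩
    have := (Γ.eq_nil_of_append_fullList_append hz.symm).2
    simp at this
  cons_cons {x y} l₁ l₂ h := by
    rintro ⟨z, hz⟩
    exact h (Γ.eq_succ_of_append_cons_cons hz.symm)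

variable {Γ} (k : Type*) [Field k]

open Classical in
/-- The sum of the coefficients of the paths from `i` to `j` whose word lies in `S`. -/
noncomputable def coeff (i j : Γ.QuiverVertex) (S : Set (List Γ.Occurrence)) :
    PathAlgebra k Γ.QuiverVertex →ₗ[k] k where
  toFun f := Finsupp.linearCombination k
    (fun p : Quiver.Path i j => if occs p ∈ S then (1 : k) else 0) (f i j)
  map_add' f g := by rw [PathAlgebra.add_apply, map_add]
  map_smul' c f := by rw [PathAlgebra.smul_apply, map_smul]; rfl

variable {k} [DecidableEq P]

theorem coeff_ofPath_of_mem {i j : Γ.QuiverVertex} {S : Set (List Γ.Occurrence)}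
    {p : Quiver.Path i j} (h : occs p ∈ S) : coeff k i j S (ofPath k p) = 1 := by
  simp [coeff, ofPath_apply, h]

theorem coeff_ofPath_of_notMem {i j a b : Γ.QuiverVertex} {S : Set (List Γ.Occurrence)}
    {p : Quiver.Path a b} (h : occs p ∉ S) : coeff k i j S (ofPath k p) = 0 := by
  by_cases hi : i = a
  · subst hi
    by_cases hj : j = b
    · subst hj
      simp [coeff, ofPath_apply, h]
    · simp [coeff, ofPath_apply_ne_right _ hj]
  · simp [coeff, ofPath_apply_ne_left _ hi]

theorem coeff_ofPath_of_ne {i j a b : Γ.QuiverVertex} {S : Set (List Γ.Occurrence)}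
    {p : Quiver.Path a b} (h : i ≠ a) : coeff k i j S (ofPath k p) = 0 := by
  simp [coeff, ofPath_apply_ne_left _ h]

theorem coeff_ofPath_congr {i j a b : Γ.QuiverVertex} {S : Set (List Γ.Occurrence)}
    {p q : Quiver.Path a b} (h : occs p ∈ S ↔ occs q ∈ S) :
    coeff k i j S (ofPath k p) = coeff k i j S (ofPath k q) := by
  classical
  by_cases hi : i = a
  · subst hi
    by_cases hj : j = b
    · subst hj
      simp only [coeff, LinearMap.coe_mk, AddHom.coe_mk, ofPath_apply,
        Finsupp.linearCombination_single]
      exact congrArg _ (if_congr h rfl rfl)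
    · simp [coeff, ofPath_apply_ne_right _ hj]
  · simp [coeff, ofPath_apply_ne_left _ hi]

theorem coeff_mul_ofPath_mul_congr {i j a b : Γ.QuiverVertex} {S : Set (List Γ.Occurrence)}
    {p q : Quiver.Path a b}
    (h : ∀ l₁ l₂, l₁ ++ (occs p ++ l₂) ∈ S ↔ l₁ ++ (occs q ++ l₂) ∈ S)
    (f g : PathAlgebra k Γ.QuiverVertex) :
    coeff k i j S (f * ofPath k p * g) = coeff k i j S (f * ofPath k q * g) := by
  induction f using induction_path with
  | zero => simp
  | add f f' hf hf' => simp only [add_mul, map_add, hf, hf']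
  | smul c f hf => simp only [smul_mul_assoc, map_smul, hf]
  | path a' a'' r =>
    induction g using induction_path with
    | zero => simp
    | add f f' hf hf' => simp only [mul_add, map_add, hf, hf']
    | smul c f hf => simp only [mul_smul_comm, map_smul, hf]
    | path b' b'' s =>
      by_cases ha : a'' = a
      · subst ha
        by_cases hb : b = b'
        · subst hb
          simp only [ofPath_mul_ofPath]
          apply coeff_ofPath_congr
          simpa only [occs_comp, List.append_assoc] using h _ _
        · simp only [mul_assoc, ofPath_mul_ofPath_of_ne _ _ hb, mul_zero]
      · simp only [ofPath_mul_ofPath_of_ne _ _ ha, zero_mul]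

theorem coeff_mul_ofPath_mul_eq_zero {i j a b : Γ.QuiverVertex} {S : Set (List Γ.Occurrence)}
    {p : Quiver.Path a b} (h : ∀ l₁ l₂, l₁ ++ (occs p ++ l₂) ∉ S)
    (f g : PathAlgebra k Γ.QuiverVertex) : coeff k i j S (f * ofPath k p * g) = 0 := by
  induction f using induction_path with
  | zero => simp
  | add f f' hf hf' => simp only [add_mul, map_add, hf, hf', add_zero]
  | smul c f hf => simp only [smul_mul_assoc, map_smul, hf, smul_zero]
  | path a' a'' r =>
    induction g using induction_path with
    | zero => simp
    | add f f' hf hf' => simp only [mul_add, map_add, hf, hf', add_zero]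
    | smul c f hf => simp only [mul_smul_comm, map_smul, hf, smul_zero]
    | path b' b'' s =>
      by_cases ha : a'' = a
      · subst ha
        by_cases hb : b = b'
        · subst hb
          simp only [ofPath_mul_ofPath]
          apply coeff_ofPath_of_notMem
          simpa only [occs_comp, List.append_assoc] using h _ _
        · simp only [mul_assoc, ofPath_mul_ofPath_of_ne _ _ hb, mul_zero, map_zero]
      · simp only [ofPath_mul_ofPath_of_ne _ _ ha, zero_mul, map_zero]

theorem IsCompatible.coeff_mul_mul_eq_zero {S : Set (List Γ.Occurrence)} (hS : Γ.IsCompatible S)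
    (i j : Γ.QuiverVertex) {r : PathAlgebra k Γ.QuiverVertex} (hr : Γ.IsRelation k r)
    (f g : PathAlgebra k Γ.QuiverVertex) : coeff k i j S (f * r * g) = 0 := by
  cases hr with
  | cycle_sub_cycle x y h =>
    obtain ⟨p, hp, hp'⟩ := Γ.exists_path_full k x (rfl : Γ.node x = Γ.node x)
    obtain ⟨q, hq, hq'⟩ :=
      Γ.exists_path_full k y (show Γ.node y = Γ.node x from h.symm)
    rw [← hp', ← hq', mul_sub, sub_mul, map_sub, sub_eq_zero]
    refine coeff_mul_ofPath_mul_congr (fun l₁ l₂ => ?_) f g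
    rw [hp, hq]
    exact ⟨hS.full l₁ l₂ h, hS.full l₁ l₂ h.symm⟩
  | cycle_mul_arrow x =>
    obtain ⟨p, hp, hp'⟩ := Γ.exists_path_full k x (rfl : Γ.node x = Γ.node x)
    obtain ⟨q, hq, hq'⟩ := Γ.exists_path_arrow k x
    rw [← hp', ← hq', ofPath_mul_ofPath]
    refine coeff_mul_ofPath_mul_eq_zero (fun l₁ l₂ => ?_) f g
    rw [occs_comp, hp, hq, List.append_assoc]
    exact hS.full_cons x l₁ l₂
  | arrow_mul_arrow x y h hne =>
    obtain ⟨p, hp, hp'⟩ := Γ.exists_path_arrow k x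
    obtain ⟨q, hq, hq'⟩ := Γ.exists_path_arrow k y
    rw [← hp', ← hq']
    -- The end of the first arrow equals the start of the second only propositionally; generalizing
    -- it allows the two paths to be composed.
    replace h : Γ.node (Γ.succ x) = Γ.node y := h
    generalize Γ.node (Γ.succ x) = a at p hp hp' h
    subst h
    rw [ofPath_mul_ofPath]
    refine coeff_mul_ofPath_mul_eq_zero (fun l₁ l₂ => ?_) f g
    rw [occs_comp, hp, hq]
    exact hS.cons_cons l₁ l₂ hne

theorem IsCompatible.coeff_eq_zero {S : Set (List Γ.Occurrence)} (hS : Γ.IsCompatible S)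
    (i j : Γ.QuiverVertex) {r : PathAlgebra k Γ.QuiverVertex}
    (hr : r ∈ TwoSidedIdeal.span {r | Γ.IsRelation k r}) : coeff k i j S r = 0 := by
  -- The statement is strengthened by arbitrary factors on both sides so that the induction passes
  -- through the absorption steps.
  suffices h : ∀ f g, coeff k i j S (f * r * g) = 0 by simpa using h 1 1
  induction hr using TwoSidedIdeal.span_induction with
  | mem r hr => exact hS.coeff_mul_mul_eq_zero i j hr
  | zero => simp
  | add x y _ _ hx hy =>
    intro f g
    rw [mul_add, add_mul, map_add, hx, hy, add_zero]
  | neg x _ hx =>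
    intro f g
    rw [mul_neg, neg_mul, map_neg, hx, neg_zero]
  | left_absorb a x _ hx =>
    intro f g
    rw [← mul_assoc, hx]
  | right_absorb b x _ hx =>
    intro f g
    rw [← mul_assoc, mul_assoc _ b g, hx]

/-! ### The quotient map and the functionals induced on the algebra. -/

variable (Γ k)

/-- The projection of the path algebra onto the Brauer configuration algebra. -/
noncomputable def proj : PathAlgebra k Γ.QuiverVertex →ₐ[k] Γ.BrauerAlgebra k :=
  RingCon.mkₐ k _

theorem proj_surjective : Function.Surjective (Γ.proj k) := RingCon.mkₐ_surjective (α := k) _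

theorem proj_eq_zero_iff (f : PathAlgebra k Γ.QuiverVertex) :
    Γ.proj k f = 0 ↔ f ∈ TwoSidedIdeal.span {r | Γ.IsRelation k r} := by
  rw [TwoSidedIdeal.mem_iff]
  exact RingCon.eq _

variable {Γ k} in
theorem proj_eq_zero {r : PathAlgebra k Γ.QuiverVertex} (h : Γ.IsRelation k r) :
    Γ.proj k r = 0 :=
  (Γ.proj_eq_zero_iff k r).2 (TwoSidedIdeal.subset_span h)

variable {Γ k} in
-- The functional is evaluated on a linear section of the projection; the choice of the section is
-- immaterial because the ideal is killed.
theorem IsCompatible.exists_dual {S : Set (List Γ.Occurrence)} (hS : Γ.IsCompatible S)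
    (i j : Γ.QuiverVertex) :
    ∃ F : Module.Dual k (Γ.BrauerAlgebra k), ∀ f, F (Γ.proj k f) = coeff k i j S f := by
  obtain ⟨g, hg⟩ := (Γ.proj k).toLinearMap.exists_rightInverse_of_surjective
    (LinearMap.range_eq_top.2 (Γ.proj_surjective k))
  refine ⟨(coeff k i j S).comp g, fun f => ?_⟩
  rw [LinearMap.comp_apply, ← sub_eq_zero, ← map_sub]
  apply hS.coeff_eq_zero
  rw [← proj_eq_zero_iff, map_sub, sub_eq_zero]
  exact LinearMap.congr_fun hg (Γ.proj k f)

end BrauerConfiguration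

/-! ### Chosen occurrences, and vertices of valency one. -/

namespace BrauerConfiguration

open PathAlgebra

variable {V P : Type*} [Fintype V] [Fintype P] (Γ : BrauerConfiguration V P)

theorem exists_fst_eq (v : V) : ∃ x : Γ.Occurrence, x.1 = v := by
  obtain ⟨i, hi⟩ := Γ.covers v
  exact ⟨⟨v, i, ⟨0, hi⟩⟩, rfl⟩

theorem exists_node_eq (i : Γ.QuiverVertex) : ∃ x : Γ.Occurrence, Γ.node x = i := by
  have h : 0 < ∑ v, Γ.freq i v := lt_trans zero_lt_one (Γ.one_lt_size i)
  obtain ⟨v, -, hv⟩ := Finset.exists_ne_zero_of_sum_ne_zero h.ne'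
  exact ⟨⟨v, i, ⟨0, Nat.pos_of_ne_zero hv⟩⟩, rfl⟩

/-- Some occurrence of a given vertex. -/
noncomputable def vertexOcc (v : V) : Γ.Occurrence := (Γ.exists_fst_eq v).choose

theorem vertexOcc_fst (v : V) : (Γ.vertexOcc v).1 = v := (Γ.exists_fst_eq v).choose_spec

/-- Some occurrence in a given polygon. -/
noncomputable def polygonOcc (i : Γ.QuiverVertex) : Γ.Occurrence := (Γ.exists_node_eq i).choose

theorem node_polygonOcc (i : Γ.QuiverVertex) : Γ.node (Γ.polygonOcc i) = i :=
  (Γ.exists_node_eq i).choose_spec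

theorem eq_of_val_eq_one {x y : Γ.Occurrence} (hx : Γ.val x.1 = 1) (h : x.1 = y.1) : x = y := by
  obtain ⟨n, rfl⟩ := Γ.exists_succ_iterate_eq h
  exact ((Γ.succ_iterate_eq_self_iff x n).2 (hx ▸ one_dvd n)).symm

theorem succ_eq_self {x : Γ.Occurrence} (hx : Γ.val x.1 = 1) : Γ.succ x = x :=
  (Γ.eq_of_val_eq_one (y := Γ.succ x) hx rfl).symm

variable {Γ} in
theorem eq_of_node_eq (hfreq : ∀ i v, 0 < Γ.freq i v → Γ.freq i v = 1) {x y : Γ.Occurrence}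
    (h : x.1 = y.1) (hn : Γ.node x = Γ.node y) : x = y := by
  obtain ⟨v, i, a⟩ := x
  obtain ⟨w, j, b⟩ := y
  obtain rfl : v = w := h
  obtain rfl : i = j := hn
  have : Subsingleton (Fin (Γ.freq i v)) := by
    rw [hfreq i v a.pos]
    infer_instance
  rw [Subsingleton.elim a b]

theorem exists_fullLength_eq (x : Γ.Occurrence) : ∃ n, Γ.fullLength x = n + 1 :=
  Nat.exists_eq_succ_of_ne_zero (lt_trans zero_lt_one (Γ.one_lt_fullLength x)).ne'

/-! ### Central elements and normal forms of paths in the quotient. -/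

variable [DecidableEq P] (k : Type*) [Field k]

theorem proj_walk_fullLength_congr {x y : Γ.Occurrence} (h : Γ.node x = Γ.node y) :
    Γ.proj k (Γ.walk k x (Γ.fullLength x)) = Γ.proj k (Γ.walk k y (Γ.fullLength y)) := by
  rw [← sub_eq_zero, ← map_sub, ← specialCycle_pow, ← specialCycle_pow]
  exact proj_eq_zero (.cycle_sub_cycle x y h)

theorem proj_walk_fullLength_mul_arrow (x : Γ.Occurrence) :
    Γ.proj k (Γ.walk k x (Γ.fullLength x)) * Γ.proj k (Γ.arrow k x) = 0 := by
  rw [← map_mul, ← specialCycle_pow]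
  exact proj_eq_zero (.cycle_mul_arrow x)

theorem proj_arrow_mul_proj_arrow {x y : Γ.Occurrence} (h : y ≠ Γ.succ x) :
    Γ.proj k (Γ.arrow k x) * Γ.proj k (Γ.arrow k y) = 0 := by
  rw [← map_mul]
  by_cases hn : Γ.node (Γ.succ x) = Γ.node y
  · exact proj_eq_zero (.arrow_mul_arrow x y hn h)
  · rw [arrow_mul_arrow_of_ne _ _ hn, map_zero]

/-- The idempotents and the arrows generate the algebra. -/
theorem mem_center_of_commute {z : Γ.BrauerAlgebra k}
    (h₁ : ∀ i, Commute z (Γ.proj k (idem k i)))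
    (h₂ : ∀ x, Commute z (Γ.proj k (Γ.arrow k x))) :
    z ∈ Subalgebra.center k (Γ.BrauerAlgebra k) := by
  rw [Subalgebra.mem_center_iff]
  intro b
  obtain ⟨f, rfl⟩ := Γ.proj_surjective k b
  suffices h : Commute z (Γ.proj k f) from h.eq.symm
  induction f using induction_path with
  | zero => rw [map_zero]; exact Commute.zero_right _
  | add f g hf hg => rw [map_add]; exact hf.add_right hg
  | smul c f hf => rw [map_smul]; exact hf.smul_right c
  | path i j p =>
    induction p with
    | nil => exact h₁ i
    | cons q a ih =>
      rw [ofPath_cons, map_mul]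
      exact ih.mul_right (h₂ _)

theorem walk_succ_mul_idem (x : Γ.Occurrence) (n : ℕ) :
    Γ.walk k x (n + 1) * idem k (Γ.node (Γ.succ^[n + 1] x)) = Γ.walk k x (n + 1) := by
  rw [walk_succ, mul_assoc, Function.iterate_succ_apply', arrow_mul_idem]

theorem commute_walk_idem {x : Γ.Occurrence} {n : ℕ} (h : Γ.succ^[n + 1] x = x)
    (i : Γ.QuiverVertex) : Commute (Γ.walk k x (n + 1)) (idem k i) := by
  have h1 := Γ.idem_mul_walk k x n
  have h2 := Γ.walk_succ_mul_idem k x n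
  rw [h] at h2
  by_cases hi : i = Γ.node x
  · subst hi
    exact h2.trans h1.symm
  · have h3 : Γ.walk k x (n + 1) * idem k i = 0 := by
      rw [← h2, mul_assoc, idem_mul_idem_of_ne (Ne.symm hi), mul_zero]
    have h4 : idem k i * Γ.walk k x (n + 1) = 0 := by
      rw [← h1, ← mul_assoc, idem_mul_idem_of_ne hi, zero_mul]
    exact h3.trans h4.symm

/-- Arrows annihilate a full cycle on both sides: if the arrow is composable with it, the cycle may
be replaced by the one at the arrow's own vertex, for which the product contains a full cycle
followed by its first arrow. -/
theorem proj_walk_fullLength_mem_center (x : Γ.Occurrence) :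
    Γ.proj k (Γ.walk k x (Γ.fullLength x)) ∈ Subalgebra.center k (Γ.BrauerAlgebra k) := by
  refine Γ.mem_center_of_commute k (fun i => ?_) fun y => ?_
  · obtain ⟨n, hn⟩ := Γ.exists_fullLength_eq x
    rw [hn]
    exact (Γ.commute_walk_idem k (hn ▸ Γ.succ_iterate_fullLength x) i).map (Γ.proj k)
  · have h1 : Γ.proj k (Γ.walk k x (Γ.fullLength x)) * Γ.proj k (Γ.arrow k y) = 0 := by
      by_cases h : Γ.node x = Γ.node y
      · rw [Γ.proj_walk_fullLength_congr k h, proj_walk_fullLength_mul_arrow]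
      · obtain ⟨n, hn⟩ := Γ.exists_fullLength_eq x
        have h2 := Γ.walk_succ_mul_idem k x n
        rw [← hn, succ_iterate_fullLength] at h2
        rw [← h2, ← map_mul, mul_assoc, idem_mul_arrow_of_ne _ _ _ h, mul_zero, map_zero]
    have h2 : Γ.proj k (Γ.arrow k y) * Γ.proj k (Γ.walk k x (Γ.fullLength x)) = 0 := by
      by_cases h : Γ.node (Γ.succ y) = Γ.node x
      -- The arrow `y` followed by the full cycle from `succ y` is also the full cycle from `y`
      -- followed by the arrow `y`.
      · rw [← Γ.proj_walk_fullLength_congr k h, ← map_mul, ← walk_succ']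
        have h3 : Γ.fullLength (Γ.succ y) = Γ.fullLength y := rfl
        rw [h3, walk_succ, succ_iterate_fullLength, map_mul, proj_walk_fullLength_mul_arrow]
      · obtain ⟨n, hn⟩ := Γ.exists_fullLength_eq x
        have h2 := Γ.idem_mul_walk k x n
        rw [← hn] at h2
        rw [← h2, ← map_mul, ← mul_assoc, arrow_mul_idem_of_ne _ _ _ h, zero_mul, map_zero]
    exact h1.trans h2.symm

/-- A loop is followed and preceded in its circular order only by itself, so its products with all
other arrows vanish. -/
theorem proj_arrow_mem_center {x : Γ.Occurrence} (hx : Γ.val x.1 = 1) :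
    Γ.proj k (Γ.arrow k x) ∈ Subalgebra.center k (Γ.BrauerAlgebra k) := by
  have hs := Γ.succ_eq_self hx
  refine Γ.mem_center_of_commute k (fun i => ?_) fun y => ?_
  · have h := (Γ.commute_walk_idem k (n := 0) hs i).map (Γ.proj k)
    rwa [walk_one] at h
  · by_cases h : y = x
    · rw [h]
    · have h1 : y ≠ Γ.succ x := by rwa [hs]
      have h2 : x ≠ Γ.succ y := fun e => h (Γ.succ_injective (e.symm.trans hs.symm))
      exact (Γ.proj_arrow_mul_proj_arrow k h1).trans (Γ.proj_arrow_mul_proj_arrow k h2).symm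

/-- A walk can be prolonged only by the next arrow of its circular order, and one of full length not
at all; any other continuation gives zero. -/
theorem proj_ofPath_cons {i j l : Γ.QuiverVertex} (p : Quiver.Path i j) (a : j ⟶ l) :
    Γ.proj k (ofPath k (p.cons a)) = 0 ∨
      ∃ x n, n < Γ.fullLength x ∧ Γ.node x = i ∧ Γ.node (Γ.succ^[n + 1] x) = l ∧
        Γ.proj k (ofPath k (p.cons a)) = Γ.proj k (Γ.walk k x (n + 1)) := by
  induction p generalizing l with
  | nil =>
    refine .inr ⟨a.1, 0, (lt_trans zero_lt_one (Γ.one_lt_fullLength _)), a.2.1, a.2.2, ?_⟩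
    rw [zero_add, walk_one, arrow_eq_ofPath]
    rfl
  | cons q b ih =>
    rw [ofPath_cons, map_mul]
    obtain h | ⟨x, n, hn, hi, hj, h⟩ := ih b
    · rw [h, zero_mul]
      exact .inl rfl
    · rw [h]
      by_cases ha : a.1 = Γ.succ^[n + 1] x
      · by_cases hn' : n + 1 < Γ.fullLength x
        · refine .inr ⟨x, n + 1, hn', hi, ?_, ?_⟩
          · rw [Function.iterate_succ_apply', ← ha]
            exact a.2.2
          · rw [ha, walk_succ _ _ _ (n + 1), map_mul]
        · have hN : n + 1 = Γ.fullLength x := by omega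
          rw [ha, hN, succ_iterate_fullLength, proj_walk_fullLength_mul_arrow]
          exact .inl rfl
      · rw [walk_succ, map_mul, mul_assoc, proj_arrow_mul_proj_arrow, mul_zero]
        · exact .inl rfl
        · rwa [← Function.iterate_succ_apply' Γ.succ]

theorem exists_dual_arrow (x : Γ.Occurrence) :
    ∃ F : Module.Dual k (Γ.BrauerAlgebra k), F (Γ.proj k (Γ.arrow k x)) = 1 := by
  obtain ⟨F, hF⟩ := (Γ.isCompatible_of_length_le_one (S := {[x]}) (by simp)).exists_dual (k := k)
    (Γ.node x) (Γ.node (Γ.succ x))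
  obtain ⟨p, hp, hp'⟩ := Γ.exists_path_arrow k x
  refine ⟨F, ?_⟩
  rw [hF, ← hp', coeff_ofPath_of_mem (by simp [hp])]

theorem proj_arrow_ne_zero (x : Γ.Occurrence) : Γ.proj k (Γ.arrow k x) ≠ 0 := by
  obtain ⟨F, hF⟩ := Γ.exists_dual_arrow k x
  intro h
  simp [h] at hF

/-! ### The family of central elements and its independence. -/

theorem coeff_one (i : Γ.QuiverVertex) (S : Set (List Γ.Occurrence)) :
    coeff k i i S 1 = coeff k i i S (idem k i) := by
  rw [one_eq_sum_idem, map_sum, Finset.sum_eq_single i]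
  · intro j _ hj
    exact coeff_ofPath_of_ne hj.symm
  · simp

variable {Γ} in
theorem coeff_one_of_nil_notMem (i j : Γ.QuiverVertex) {S : Set (List Γ.Occurrence)}
    (h : [] ∉ S) : coeff k i j S 1 = 0 := by
  rw [one_eq_sum_idem, map_sum]
  exact Finset.sum_eq_zero fun l _ => coeff_ofPath_of_notMem h

/-- The identity, the loops and the full powers of the special cycles. -/
noncomputable def centralFamily :
    Option ({v : V // Γ.val v = 1} ⊕ Γ.QuiverVertex) → Γ.BrauerAlgebra k
  | none => 1
  | some (.inl v) => Γ.proj k (Γ.arrow k (Γ.vertexOcc v))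
  | some (.inr i) =>
    Γ.proj k (Γ.walk k (Γ.polygonOcc i) (Γ.fullLength (Γ.polygonOcc i)))

theorem proj_arrow_mem_span {x : Γ.Occurrence} (hx : Γ.val x.1 = 1) :
    Γ.proj k (Γ.arrow k x) ∈ Submodule.span k (Set.range (Γ.centralFamily k)) := by
  rw [Γ.eq_of_val_eq_one hx (Γ.vertexOcc_fst x.1).symm]
  exact Submodule.subset_span ⟨some (.inl ⟨x.1, hx⟩), rfl⟩

theorem proj_walk_fullLength_mem_span (x : Γ.Occurrence) :
    Γ.proj k (Γ.walk k x (Γ.fullLength x))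
      ∈ Submodule.span k (Set.range (Γ.centralFamily k)) := by
  rw [Γ.proj_walk_fullLength_congr k (Γ.node_polygonOcc (Γ.node x)).symm]
  exact Submodule.subset_span ⟨some (.inr (Γ.node x)), rfl⟩

theorem span_centralFamily_le : Submodule.span k (Set.range (Γ.centralFamily k))
    ≤ Subalgebra.toSubmodule (Subalgebra.center k (Γ.BrauerAlgebra k)) := by
  rw [Submodule.span_le]
  rintro _ ⟨(_ | v | i), rfl⟩
  · exact one_mem (Subalgebra.center k (Γ.BrauerAlgebra k))
  · exact Γ.proj_arrow_mem_center k (by rw [vertexOcc_fst]; exact v.2)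
  · exact Γ.proj_walk_fullLength_mem_center k _

/-- The dual functionals read off the trivial path at one node, the one-letter word of each loop,
and all full words based at each polygon. -/
theorem linearIndependent_centralFamily [Nonempty Γ.QuiverVertex] :
    LinearIndependent k (Γ.centralFamily k) := by
  obtain ⟨i₀⟩ : Nonempty Γ.QuiverVertex := ‹_›
  obtain ⟨F, hF⟩ := (Γ.isCompatible_of_length_le_one (S := {[]}) (by simp)).exists_dual (k := k)
    i₀ i₀
  choose G hG using fun x : Γ.Occurrence =>
    (Γ.isCompatible_of_length_le_one (S := {[x]}) (by simp)).exists_dual (k := k)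
    (Γ.node x) (Γ.node (Γ.succ x))
  choose H hH using fun i : Γ.QuiverVertex =>
    Γ.isCompatible_range_fullList.exists_dual (k := k) i i
  -- Full words have at least two letters, which separates them from the identity and from the
  -- loops.
  have hfull : ∀ x (l : List Γ.Occurrence), l.length ≤ 1 → l ≠ Γ.fullList x := by
    rintro x l hl rfl
    rw [length_fullList] at hl
    exact (Γ.one_lt_fullLength x).not_ge hl
  have one_eq : (1 : Γ.BrauerAlgebra k) = Γ.proj k 1 := (map_one _).symm
  refine LinearIndependent.of_pairwise_dual_eq_zero_one _
    (fun | none => F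
         | some (.inl v) => G (Γ.vertexOcc v)
         | some (.inr i) => H i) ?_ ?_
  · rintro (_ | v | i) (_ | w | j) hne
    · exact absurd rfl hne
    · obtain ⟨p, hp, hp'⟩ := Γ.exists_path_arrow k (Γ.vertexOcc w)
      simp only [centralFamily, hF, ← hp']
      exact coeff_ofPath_of_notMem (by simp [hp])
    · obtain ⟨p, hp, hp'⟩ := Γ.exists_path_full k (Γ.polygonOcc j) rfl
      simp only [centralFamily, hF, ← specialCycle_pow, ← hp']
      exact coeff_ofPath_of_notMem (by simpa [hp] using (hfull _ [] (by simp)).symm)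
    · simp only [centralFamily, one_eq, hG]
      exact coeff_one_of_nil_notMem k _ _ (by simp)
    · obtain ⟨p, hp, hp'⟩ := Γ.exists_path_arrow k (Γ.vertexOcc w)
      simp only [centralFamily, hG, ← hp']
      refine coeff_ofPath_of_notMem ?_
      rw [hp, Set.mem_singleton_iff, List.singleton_inj]
      intro h
      refine hne (congrArg _ (congrArg _ (Subtype.ext ?_)))
      rw [← Γ.vertexOcc_fst v, ← Γ.vertexOcc_fst w, h]
    · obtain ⟨p, hp, hp'⟩ := Γ.exists_path_full k (Γ.polygonOcc j) rfl
      simp only [centralFamily, hG, ← specialCycle_pow, ← hp']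
      exact coeff_ofPath_of_notMem (by simpa [hp] using (hfull _ [_] (by simp)).symm)
    · simp only [centralFamily, one_eq, hH]
      exact coeff_one_of_nil_notMem k _ _ (by rintro ⟨x, hx⟩; exact hfull x [] (by simp) hx.symm)
    · obtain ⟨p, hp, hp'⟩ := Γ.exists_path_arrow k (Γ.vertexOcc w)
      simp only [centralFamily, hH, ← hp']
      exact coeff_ofPath_of_notMem
        (by rintro ⟨x, hx⟩; exact hfull x _ (by simp) (hx.trans hp).symm)
    · obtain ⟨p, hp, hp'⟩ := Γ.exists_path_full k (Γ.polygonOcc j) (Γ.node_polygonOcc j)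
      simp only [centralFamily, hH, ← specialCycle_pow, ← hp']
      exact coeff_ofPath_of_ne (fun h : i = j => hne (by rw [h]))
  · rintro (_ | v | i)
    · simp only [centralFamily, one_eq, hF, coeff_one]
      exact coeff_ofPath_of_mem (by simp [occs_nil])
    · obtain ⟨p, hp, hp'⟩ := Γ.exists_path_arrow k (Γ.vertexOcc v)
      simp only [centralFamily, hG, ← hp']
      exact coeff_ofPath_of_mem hp
    · obtain ⟨p, hp, hp'⟩ := Γ.exists_path_full k (Γ.polygonOcc i) (Γ.node_polygonOcc i)
      simp only [centralFamily, hH, ← specialCycle_pow, ← hp']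
      exact coeff_ofPath_of_mem ⟨_, hp.symm⟩

end BrauerConfiguration

/-! ### The family spans the center. -/

namespace BrauerConfiguration

open PathAlgebra

variable {V P : Type*} [Fintype V] [Fintype P] (Γ : BrauerConfiguration V P)

variable {Γ} in
-- Iterated successors reach every occurrence of a vertex, so constancy along arrows gives equality
-- on polygons that share a vertex.
theorem Connected.eq_of_forall_succ {α : Type*} (hconn : Γ.Connected) {c : Γ.QuiverVertex → α}
    (h : ∀ x, c (Γ.node x) = c (Γ.node (Γ.succ x))) (i j : Γ.QuiverVertex) : c i = c j := by
  have hn : ∀ x n, c (Γ.node x) = c (Γ.node (Γ.succ^[n] x)) := fun x n => by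
    induction n with
    | zero => rfl
    | succ n ih => rw [ih, h, Function.iterate_succ_apply']
  have hv : ∀ (i j : P) (v : V), 0 < Γ.freq i v → 0 < Γ.freq j v → c i = c j := by
    intro i j v hi hj
    let x : Γ.Occurrence := ⟨v, i, ⟨0, hi⟩⟩
    let y : Γ.Occurrence := ⟨v, j, ⟨0, hj⟩⟩
    obtain ⟨n, hxy⟩ := Γ.exists_succ_iterate_eq (x := x) (y := y) rfl
    exact (hn x n).trans (by rw [hxy]; rfl)
  obtain ⟨w⟩ := hconn.preconnected i j
  induction w with
  | nil => rfl
  | cons hadj _ ih =>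
    refine Eq.trans ?_ ih
    obtain ⟨-, ⟨v, h1, h2⟩ | ⟨v, h1, h2⟩⟩ := SimpleGraph.fromRel_adj _ _ _ |>.1 hadj
    · exact hv _ _ v h1 h2
    · exact hv _ _ v h2 h1

variable [DecidableEq P] (k : Type*) [Field k]

variable {Γ} in
theorem proj_ofPath_closed_mem (hmult : ∀ v, Γ.mult v = if Γ.val v = 1 then 2 else 1)
    (hfreq : ∀ i v, 0 < Γ.freq i v → Γ.freq i v = 1) {i : Γ.QuiverVertex}
    (p : Quiver.Path i i) :
    Γ.proj k (ofPath k p) ∈ Submodule.span k {Γ.proj k (idem k i)} ⊔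
      Submodule.span k (Set.range (Γ.centralFamily k)) := by
  cases p with
  | nil => exact Submodule.mem_sup_left (Submodule.mem_span_singleton_self _)
  | cons q a =>
    refine Submodule.mem_sup_right ?_
    obtain h | ⟨x, n, hn, hi, hj, h⟩ := Γ.proj_ofPath_cons k q a
    · rw [h]
      exact zero_mem _
    · rw [h]
      -- The walk is back in its polygon, where its vertex occurs only once.
      have hx : Γ.succ^[n + 1] x = x :=
        eq_of_node_eq hfreq (Γ.succ_iterate_fst x _) (hj.trans hi.symm)
      have hm := hmult x.1
      by_cases hN : n + 1 = Γ.fullLength x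
      · rw [hN]
        exact Γ.proj_walk_fullLength_mem_span k x
      · by_cases hv : Γ.val x.1 = 1
        -- Here the full length is 2, so a shorter walk is the loop itself.
        · have h0 : n = 0 := by
            rw [if_pos hv] at hm
            rw [fullLength, hm, hv] at hn hN
            omega
          rw [h0, zero_add, walk_one]
          exact Γ.proj_arrow_mem_span k hv
        · rw [if_neg hv] at hm
          -- Here the full length is `val`, which divides `n + 1`, so no shorter closed walk exists.
          have hd := Nat.le_of_dvd (Nat.succ_pos n) ((Γ.succ_iterate_eq_self_iff x _).1 hx)
          rw [fullLength, hm, one_mul] at hn hN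
          omega

variable {Γ} in
theorem center_le_span (hconn : Γ.Connected)
    (hmult : ∀ v, Γ.mult v = if Γ.val v = 1 then 2 else 1)
    (hfreq : ∀ i v, 0 < Γ.freq i v → Γ.freq i v = 1) :
    Subalgebra.toSubmodule (Subalgebra.center k (Γ.BrauerAlgebra k))
      ≤ Submodule.span k (Set.range (Γ.centralFamily k)) := by
  intro z hz
  obtain ⟨f, rfl⟩ := Γ.proj_surjective k z
  have hcomm := Subalgebra.mem_center_iff.1 ((Subalgebra.mem_toSubmodule _).1 hz)
  -- Centrality gives `e_i z = e_i e_i z = e_i z e_i`, so only closed paths are needed.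
  have hsum : Γ.proj k f = ∑ i, Γ.proj k (idem k i * f * idem k i) := by
    conv_lhs => rw [← one_mul (Γ.proj k f), ← map_one (Γ.proj k), one_eq_sum_idem, map_sum,
      Finset.sum_mul]
    refine Finset.sum_congr rfl fun i _ => ?_
    rw [map_mul, map_mul, mul_assoc, ← hcomm, ← mul_assoc,
      ← map_mul _ (idem k i) (idem k i), idem_mul_idem]
  have hcorner : ∀ i, ∃ c : k, Γ.proj k (idem k i * f * idem k i) - c • Γ.proj k (idem k i)
      ∈ Submodule.span k (Set.range (Γ.centralFamily k)) := by
    intro i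
    have h : Γ.proj k (idem k i * f * idem k i) ∈ Submodule.span k {Γ.proj k (idem k i)} ⊔
        Submodule.span k (Set.range (Γ.centralFamily k)) := by
      have h1 := idem_mul_mul_idem_mem_span (k := k) i f
      revert h1
      generalize idem k i * f * idem k i = g
      intro h1
      induction h1 using Submodule.span_induction with
      | mem g hg =>
        obtain ⟨p, rfl⟩ := hg
        exact proj_ofPath_closed_mem k hmult hfreq p
      | zero => rw [map_zero]; exact zero_mem _
      | add x y _ _ hx hy => rw [map_add]; exact add_mem hx hy
      | smul c x _ hx => rw [map_smul]; exact Submodule.smul_mem _ c hx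
    obtain ⟨y, hy, w, hw, hyw⟩ := Submodule.mem_sup.1 h
    obtain ⟨c, rfl⟩ := Submodule.mem_span_singleton.1 hy
    exact ⟨c, by rwa [← hyw, add_sub_cancel_left]⟩
  choose c hc using hcorner
  have hmem : Γ.proj k f - ∑ i, c i • Γ.proj k (idem k i)
      ∈ Submodule.span k (Set.range (Γ.centralFamily k)) := by
    rw [hsum, ← Finset.sum_sub_distrib]
    exact sum_mem fun i _ => hc i
  -- It differs from the central element `proj f` by an element of the span, which is itself
  -- central.
  have hcentral : ∑ i, c i • Γ.proj k (idem k i)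
      ∈ Subalgebra.center k (Γ.BrauerAlgebra k) := by
    have := sub_mem hz (Γ.span_centralFamily_le k hmem)
    rwa [sub_sub_cancel] at this
  -- Multiplying by an arrow on the left picks out the coefficient at its target, on the right the
  -- one at its source; the arrow is nonzero in the quotient.
  have hstep : ∀ x, c (Γ.node x) = c (Γ.node (Γ.succ x)) := by
    intro x
    have h := Subalgebra.mem_center_iff.1 hcentral (Γ.proj k (Γ.arrow k x))
    rw [Finset.mul_sum, Finset.sum_mul, Finset.sum_eq_single (Γ.node (Γ.succ x)),
      Finset.sum_eq_single (Γ.node x)] at h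
    · rw [mul_smul_comm, smul_mul_assoc, ← map_mul, ← map_mul, arrow_mul_idem,
        idem_mul_arrow] at h
      exact (smul_left_injective k (Γ.proj_arrow_ne_zero k x) h).symm
    · intro i _ hi
      rw [smul_mul_assoc, ← map_mul, idem_mul_arrow_of_ne _ _ _ hi, map_zero, smul_zero]
    · simp
    · intro i _ hi
      rw [mul_smul_comm, ← map_mul, arrow_mul_idem_of_ne _ _ _ hi.symm, map_zero, smul_zero]
    · simp
  obtain ⟨i₀⟩ : Nonempty Γ.QuiverVertex := hconn.nonempty
  have hone : ∑ i, c i • Γ.proj k (idem k i) = c i₀ • (1 : Γ.BrauerAlgebra k) := by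
    rw [← map_one (Γ.proj k), one_eq_sum_idem, map_sum, Finset.smul_sum]
    exact Finset.sum_congr rfl fun i _ => by rw [hconn.eq_of_forall_succ hstep i i₀]
  rw [hone] at hmem
  have h1 : (1 : Γ.BrauerAlgebra k) ∈ Submodule.span k (Set.range (Γ.centralFamily k)) :=
    Submodule.subset_span ⟨none, rfl⟩
  have := add_mem hmem (Submodule.smul_mem _ (c i₀) h1)
  rwa [sub_add_cancel] at this

end BrauerConfiguration

theorem proposition3p4 {k V P : Type*} [Field k] [Fintype V] [Fintype P] [DecidableEq P]
    (Γ : BrauerConfiguration V P) (m n : ℕ)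
    (hconn : Γ.Connected)
    (hmult : ∀ v, Γ.mult v = if Γ.val v = 1 then 2 else 1)
    (hfreq : ∀ i v, 0 < Γ.freq i v → Γ.freq i v = 1)
    (hm : Fintype.card P = m)
    (hn : (Finset.univ.filter fun v => Γ.val v = 1).card = n) :
    Module.finrank k (Subalgebra.center k (Γ.BrauerAlgebra k)) = m + n + 1 := by
  have : Nonempty Γ.QuiverVertex := hconn.nonempty
  rw [← Subalgebra.finrank_toSubmodule,
    le_antisymm (BrauerConfiguration.center_le_span k hconn hmult hfreq)
      (Γ.span_centralFamily_le k), finrank_span_eq_card (Γ.linearIndependent_centralFamily k),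
    Fintype.card_option, Fintype.card_sum, Fintype.card_subtype, hn]
  change n + Fintype.card P + 1 = _
  rw [hm, add_comm n m]
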